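/- Let $a\ge -1$ be an integer, and let $\rho>a+1$ and $\rho'\in(-2,-1)$ be the roots in these intervals of the polynomial $x^3-ax^2-(a+3)x-1$ (a "simplest cubic field" polynomial; all three of its roots are real and lie in the totally real cubic field $K=\mathbb{Q}(\rho)$). The signature of $\alpha\in K$ is the tuple $\mathfrak{s}(\alpha)$ of the signs of $\sigma(\alpha)$, where $\sigma$ runs through the embeddings of $K$ into $\mathbb{R}$. For a signature $\mathfrak{s}$, an element $\alpha\in\mathbb{Z}[\rho]$ of signature $\mathfrak{s}$ is called $\mathfrak{s}$-indecomposable if it is not the sum of two elements of $\mathbb{Z}[\rho]$ of signature $\mathfrak{s}$. The Jacobi–Perron (JPA) expansion of $\beta^{(0)}=(\beta^{(0)}_1,\dots,\beta^{(0)}_n)\in\mathbb{R}^n$ is the sequence of vectors given by $$\beta^{(k+1)}=\bigl(\beta_2^{(k)}-b_2^{(k)}\beta_1^{(k)},\dots,\beta_n^{(k)}-b_n^{(k)}\beta_1^{(k)},\beta_1^{(k)}\bigr),\qquad b_i^{(k)}=\bigl\lfloor \beta_i^{(k)}/\beta_1^{(k)}\bigr\rfloor ,$$ and its semiconvergents are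 the numbers $\beta_i^{(k)}-j\beta_1^{(k)}$ with $k\ge 0$, $2\le i\le n$ and $0\le j\le b_i^{(k)}-1$. Then every semiconvergent $\delta$ of the JPA expansion of $(1,-\rho',\rho'^2)$ lies in $\mathbb{Z}[\rho]$ and is $\mathfrak{s}$-indecomposable in its signature $\mathfrak{s}=\mathfrak{s}(\delta)$. Moreover, $\delta=\varepsilon\alpha$, where $\varepsilon$ is a unit of $\mathbb{Z}[\rho]$ and $\alpha$ is a totally positive indecomposable element of $\mathbb{Z}[\rho]$ (that is, $\mathfrak{s}$-indecomposable for $\mathfrak{s}=(+,+,+)$) which is either $1$ or one of the elements $$\theta'_{v,W}=-v-\bigl(v(a+2)+1+W\bigr)\rho'+(v+1)\rho'^2,\qquad 0\le v\le a,\quad 0\le W\le a-v.$$ -/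

import Mathlib

/-! ### Signatures and indecomposable elements -/

/-- The signature of `x`: the family of the signs of its images under all embeddings `K → ℝ`.
It is used for totally real number fields `K`. -/
noncomputable def signature {K : Type*} [Field K] (x : K) : (K →+* ℝ) → SignType :=
  fun σ => SignType.sign (σ x)

/-- `x` is an `s`-indecomposable element of the order `O`: it lies in `O`, has signature `s`,
and is not a sum of two elements of `O` of signature `s`. -/
def IsSIndecomposable {K : Type*} [Field K] (O : Subalgebra ℤ K) (s : (K →+* ℝ) → SignType)
    (x : K) : Prop :=
  (x ∈ O ∧ signature x = s) ∧
    ¬ ∃ y ∈ O, ∃ z ∈ O, signature y = s ∧ signature z = s ∧ x = y + z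

/-- The signature `(+, +, …, +)`. -/
def totallyPositive (K : Type*) [Field K] : (K →+* ℝ) → SignType := fun _ => 1

/-! ### The homogeneous Jacobi--Perron algorithm

A vector `(β₁, …, β_{n+1})` is a function on `Fin (n + 1)`; `β 0` is its first coordinate. -/

/-- One step of the algorithm:
`(β₁, …, β_{n+1}) ↦ (β₂ - b₂ β₁, …, β_{n+1} - b_{n+1} β₁, β₁)` with `bᵢ = ⌊βᵢ / β₁⌋`. -/
noncomputable def jpaStep {n : ℕ} (β : Fin (n + 1) → ℝ) : Fin (n + 1) → ℝ :=
  Fin.snoc (α := fun _ => ℝ) (fun i : Fin n => β i.succ - ⌊β i.succ / β 0⌋ * β 0) (β 0)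

/-- The `k`-th vector of the Jacobi--Perron expansion of `β`. -/
noncomputable def jpa {n : ℕ} (β : Fin (n + 1) → ℝ) (k : ℕ) : Fin (n + 1) → ℝ :=
  jpaStep^[k] β

/-- `δ` is a semiconvergent of the Jacobi--Perron expansion of `β`: it equals
`βᵢ⁽ᵏ⁾ - j β₁⁽ᵏ⁾` for some `k ≥ 0`, some coordinate `i` other than the first one and some
`0 ≤ j ≤ ⌊βᵢ⁽ᵏ⁾ / β₁⁽ᵏ⁾⌋ - 1`. -/
def IsSemiconvergent {n : ℕ} (β : Fin (n + 1) → ℝ) (δ : ℝ) : Prop :=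
  ∃ (k : ℕ) (i : Fin n) (j : ℕ),
    (j : ℤ) ≤ ⌊jpa β k i.succ / jpa β k 0⌋ - 1 ∧ δ = jpa β k i.succ - j * jpa β k 0

/-! ### The simplest cubic fields -/

/-- The real number field `ℚ(ρ)`. -/
noncomputable abbrev realField (ρ : ℝ) : IntermediateField ℚ ℝ :=
  IntermediateField.adjoin ℚ {ρ}

/-- The order `ℤ[ρ]` of `ℚ(ρ)`. -/
noncomputable abbrev realOrder (ρ : ℝ) : Subalgebra ℤ (realField ρ) :=
  Algebra.adjoin ℤ {IntermediateField.AdjoinSimple.gen ℚ ρ}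

/-- `-v - (v(a+2) + 1 + W) x + (v+1) x²`. -/
def triangleElement (a : ℤ) (v W : ℕ) (x : ℝ) : ℝ :=
  -v - (v * (a + 2) + 1 + W) * x + (v + 1) * x ^ 2

/-!
Write `e = ρ⁻¹`, so that `ρ' = -(1 + e)` and both `e` and `1 + e` are units of `ℤ[ρ]`. A
Jacobi–Perron step commutes with scaling, so the expansion of `(1, 1 + e, (1 + e)²)` only has to be
followed up to units, where it is eventually periodic and runs through a short explicit list of
vectors. All semiconvergents read off this list are unit multiples of `1` or of some `θ'_{v,W}`.

The order `ℤ[ρ]` has the `ℤ`-basis `1, ρ', ρ'²`, and the functional `p + qρ' + rρ'² ↦ p + r` is a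
combination of the three real embeddings with positive coefficients. It is therefore at least `1` on
totally positive elements of `ℤ[ρ]`, so a totally positive element of value `1` is indecomposable.
The elements `1` and `θ'_{v,W}` have value `1`, and multiplication by a unit preserves
indecomposability in the corresponding signature.
-/

/-! ### Invariants of the Jacobi–Perron algorithm -/

theorem jpaStep_smul {n : ℕ} {c : ℝ} (hc : c ≠ 0) (β : Fin (n + 1) → ℝ) :
    jpaStep (c • β) = c • jpaStep β := by
  funext i
  refine Fin.lastCases (by simp [jpaStep]) (fun i => ?_) i
  simp only [jpaStep, Fin.snoc_castSucc, Pi.smul_apply, smul_eq_mul, mul_div_mul_left _ _ hc]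
  ring

theorem jpaStep_vec3 (x y z : ℝ) :
    jpaStep ![x, y, z] = ![y - ⌊y / x⌋ * x, z - ⌊z / x⌋ * x, x] := by
  funext i
  fin_cases i <;> simp [jpaStep, Fin.snoc]

theorem IsSemiconvergent.of_invariant {n : ℕ} {V : Set (Fin (n + 1) → ℝ)} {G : ℝ → Prop}
    (hstep : ∀ β ∈ V, jpaStep β ∈ V)
    (hG : ∀ β ∈ V, ∀ (i : Fin n) (j : ℕ), (j : ℤ) < ⌊β i.succ / β 0⌋ → G (β i.succ - j * β 0))
    {β : Fin (n + 1) → ℝ} (hβ : β ∈ V) {δ : ℝ} (hδ : IsSemiconvergent β δ) : G δ := by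
  obtain ⟨k, i, j, hj, rfl⟩ := hδ
  have hk : jpa β k ∈ V := Set.MapsTo.iterate hstep k hβ
  exact hG _ hk i j (by omega)

/-! ### Unit multiples of triangle elements -/

/-- The inverse `e = ρ⁻¹` of the positive root `ρ` of `x³ - ax² - (a+3)x - 1`. The other two roots
are `ρ' = -(1 + e)` and `-e / (1 + e)`. -/
structure IsInvRoot (a : ℤ) (e : ℝ) : Prop where
  pos : 0 < e
  rel : a * e + (a + 3) * e ^ 2 + e ^ 3 = 1

/-- The multiplicative group generated by the units `e = ρ⁻¹` and `1 + e = -ρ'`, encoded as a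
submonoid of `ℝ`. -/
def rootUnits (e : ℝ) : Submonoid ℝ :=
  Submonoid.closure {e, e⁻¹, 1 + e, (1 + e)⁻¹}

/-- `α` is `1` or one of the elements `θ'_{v,W}` of the statement, for `ρ' = x`. -/
def IsOneOrTriangle (a : ℤ) (x α : ℝ) : Prop :=
  α = 1 ∨ ∃ v W : ℕ, (v : ℤ) ≤ a ∧ (W : ℤ) ≤ a - v ∧ α = triangleElement a v W x

/-- `δ` is a unit times `1` or a triangle element: the shape shown to be shared by all
semiconvergents. Here `ρ' = -(1 + e)`. -/
def IsUnitMulTriangle (a : ℤ) (e δ : ℝ) : Prop :=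
  ∃ u ∈ rootUnits e, ∃ α, IsOneOrTriangle a (-(1 + e)) α ∧ δ = u * α

section Units

variable (e : ℝ)

theorem self_mem_rootUnits : e ∈ rootUnits e := Submonoid.subset_closure (by simp)

theorem inv_mem_rootUnits : e⁻¹ ∈ rootUnits e := Submonoid.subset_closure (by simp)

theorem one_add_mem_rootUnits : 1 + e ∈ rootUnits e := Submonoid.subset_closure (by simp)

theorem inv_one_add_mem_rootUnits : (1 + e)⁻¹ ∈ rootUnits e :=
  Submonoid.subset_closure (by simp)

theorem div_one_add_mem_rootUnits : e / (1 + e) ∈ rootUnits e :=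
  div_eq_mul_inv e _ ▸ mul_mem (self_mem_rootUnits e) (inv_one_add_mem_rootUnits e)

variable {e}

theorem pos_of_mem_rootUnits (he : 0 < e) {u : ℝ} (hu : u ∈ rootUnits e) : 0 < u := by
  suffices h : rootUnits e ≤ Submonoid.pos ℝ from h hu
  refine Submonoid.closure_le.2 ?_
  rintro _ (rfl | rfl | rfl | rfl) <;> exact Submonoid.mem_pos.2 (by positivity)

end Units

namespace IsUnitMulTriangle

variable {a : ℤ} {e δ : ℝ}

theorem of_mem (hδ : δ ∈ rootUnits e) : IsUnitMulTriangle a e δ :=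
  ⟨δ, hδ, 1, Or.inl rfl, (mul_one δ).symm⟩

theorem one : IsUnitMulTriangle a e 1 := of_mem (one_mem _)

theorem unit_mul {u : ℝ} (h : IsUnitMulTriangle a e δ) (hu : u ∈ rootUnits e) :
    IsUnitMulTriangle a e (u * δ) := by
  obtain ⟨c, hc, α, hα, rfl⟩ := h
  exact ⟨u * c, mul_mem hu hc, α, hα, (mul_assoc _ _ _).symm⟩

-- The denominators are cleared so that an application is a polynomial identity modulo the cubic
-- relation satisfied by `e`.
theorem of_mul_pow_eq (he : 0 < e) (k l : ℕ) {v W : ℤ} (hv : 0 ≤ v) (hW : 0 ≤ W)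
    (hvW : v + W ≤ a) (h : δ * (1 + e) ^ k =
      e ^ l * (-v + (v * (a + 2) + 1 + W) * (1 + e) + (v + 1) * (1 + e) ^ 2)) :
    IsUnitMulTriangle a e δ := by
  lift v to ℕ using hv
  lift W to ℕ using hW
  refine ⟨e ^ l * (1 + e)⁻¹ ^ k, mul_mem (pow_mem (self_mem_rootUnits e) l)
    (pow_mem (inv_one_add_mem_rootUnits e) k), _,
    Or.inr ⟨v, W, by omega, by omega, rfl⟩, ?_⟩
  have h1 : (1 + e) ^ k ≠ 0 := by positivity
  rw [inv_pow, mul_right_comm, ← div_eq_mul_inv, eq_div_iff h1, h]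
  simp only [triangleElement, Int.cast_natCast]
  ring

end IsUnitMulTriangle

namespace IsInvRoot

variable {a : ℤ} {e : ℝ}

theorem div_eq (H : IsInvRoot a e) : e / (1 + e) = (a + 2) * e + e ^ 2 - 1 := by
  have he := H.pos
  field_simp
  linear_combination -H.rel

theorem one_eq (H : IsInvRoot a e) : 1 = (a + 1) * e + e ^ 2 + e * (e / (1 + e)) := by
  rw [H.div_eq]
  linear_combination -H.rel

theorem div_pos (H : IsInvRoot a e) : 0 < e / (1 + e) := by
  have := H.pos
  positivity

theorem div_lt_self (H : IsInvRoot a e) : e / (1 + e) < e :=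
  _root_.div_lt_self H.pos (lt_add_of_pos_right 1 H.pos)

theorem sub_div (H : IsInvRoot a e) : e - e / (1 + e) = e * (e / (1 + e)) := by
  have := H.pos
  field_simp
  ring

theorem lt_one (H : IsInvRoot a e) (ha : -1 ≤ a) : e < 1 := by
  have ha' : (0 : ℝ) ≤ a + 1 := by exact_mod_cast (by omega : (0 : ℤ) ≤ a + 1)
  have h := H.one_eq
  have h1 : 0 ≤ (a + 1) * e := mul_nonneg ha' H.pos.le
  nlinarith [mul_pos H.pos H.div_pos, H.pos]

theorem add_one_mul_lt (H : IsInvRoot a e) : (a + 1) * e < 1 - e ^ 2 := by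
  linarith [H.one_eq, mul_pos H.pos H.div_pos]

theorem one_lt_add_two_mul (H : IsInvRoot a e) (ha : 0 ≤ a) : 1 < (a + 2) * e := by
  have he := H.pos
  have ha' : (0 : ℝ) ≤ a * e := mul_nonneg (by exact_mod_cast ha) he.le
  have h1 : e + e ^ 2 < 1 := by linarith [H.add_one_mul_lt]
  have h2 : e / (1 + e) < 1 - e := by
    rw [div_lt_iff₀ (by positivity)]
    linarith
  nlinarith [H.one_eq]

theorem two_mul_add_sq_lt_one (H : IsInvRoot a e) (ha : 1 ≤ a) : 2 * e + e ^ 2 < 1 := by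
  have ha' : (1 : ℝ) ≤ a := by exact_mod_cast ha
  nlinarith [H.add_one_mul_lt, H.pos]

theorem isUnitMulTriangle_one_sub_mul (H : IsInvRoot a e) {j : ℤ} (hj : 0 ≤ j) (hja : j ≤ a) :
    IsUnitMulTriangle a e (1 - j * e) := by
  rcases hj.eq_or_lt with rfl | hj
  · simpa using IsUnitMulTriangle.one
  · refine .of_mul_pow_eq H.pos 2 2 (v := a + 1 - j) (W := 0) (by omega) le_rfl (by omega) ?_
    push_cast
    linear_combination (-1 - (a + 2 - j) * e) * H.rel

theorem isUnitMulTriangle_one_sub_mul_sub (H : IsInvRoot a e) {i j : ℤ} (hj : 1 ≤ j) (hi : 0 ≤ i)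
    (hij : 2 * j + i ≤ a) : IsUnitMulTriangle a e (1 - j * (2 * e + e ^ 2) - i * e) := by
  refine .of_mul_pow_eq H.pos 1 2 (v := a - 2 * j - i) (W := j + 1 + i)
    (by omega) (by omega) (by omega) ?_
  push_cast
  linear_combination (-1 - (a - 2 * j - i + 1) * e) * H.rel

theorem isUnitMulTriangle_add_self (H : IsInvRoot a e) {k : ℤ} (hk : 1 ≤ k) (hka : k ≤ a + 2) :
    IsUnitMulTriangle a e (k + e) := by
  rcases hk.eq_or_lt with rfl | hk
  · exact_mod_cast IsUnitMulTriangle.of_mem (one_add_mem_rootUnits e)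
  · refine .of_mul_pow_eq H.pos 1 0 (v := 0) (W := k - 2) le_rfl (by omega) (by omega) ?_
    push_cast
    ring

theorem isUnitMulTriangle_add_div (H : IsInvRoot a e) {k : ℤ} (hk : 1 ≤ k) (hka : k ≤ a + 1) :
    IsUnitMulTriangle a e (k + e / (1 + e)) := by
  refine .of_mul_pow_eq H.pos 1 1 (v := k - 1) (W := a + 1 - k)
    (by omega) (by omega) (by omega) ?_
  rw [H.div_eq]
  push_cast
  linear_combination (1 - k) * H.rel

theorem isUnitMulTriangle_two_add (H : IsInvRoot a e) (ha : -1 ≤ a) :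
    IsUnitMulTriangle a e (2 + e) := by
  rcases ha.eq_or_lt with rfl | ha
  · have h : 2 + e = (1 + e) * e⁻¹ ^ 2 := by
      have he := H.pos
      have R := H.rel
      push_cast at R
      field_simp
      linear_combination R
    rw [h]
    exact .of_mem (mul_mem (one_add_mem_rootUnits e) (pow_mem (inv_mem_rootUnits e) 2))
  · exact_mod_cast H.isUnitMulTriangle_add_self (k := 2) (by norm_num) (by omega)

theorem isUnitMulTriangle_two_mul_add_sq (H : IsInvRoot a e) (ha : -1 ≤ a) :
    IsUnitMulTriangle a e (2 * e + e ^ 2) := by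
  convert (H.isUnitMulTriangle_two_add ha).unit_mul (self_mem_rootUnits e) using 1
  ring

theorem isUnitMulTriangle_one_sub_add_one_mul (H : IsInvRoot a e) (ha : -1 ≤ a) :
    IsUnitMulTriangle a e (1 - (a + 1) * e) := by
  convert (H.isUnitMulTriangle_two_add ha).unit_mul
    (mul_mem (self_mem_rootUnits e) (div_one_add_mem_rootUnits e)) using 1
  have := H.pos
  field_simp
  linear_combination -H.rel

end IsInvRoot

theorem isUnitMulTriangle_add_sq {a : ℤ} {e : ℝ} : IsUnitMulTriangle a e (e + e ^ 2) := by
  convert IsUnitMulTriangle.of_mem (mul_mem (self_mem_rootUnits e) (one_add_mem_rootUnits e))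
    using 1
  ring

/-! ### The expansion of `(1, -ρ', ρ'²)` -/

/-- The digit `b = ⌊y / x⌋` of a Jacobi–Perron step, together with the required shape of the
semiconvergents `y - jx` it gives rise to. -/
structure IsDigit (a : ℤ) (e x y : ℝ) (b : ℤ) : Prop where
  le : b * x ≤ y
  lt : y < (b + 1) * x
  semi : ∀ j : ℤ, 0 ≤ j → j < b → IsUnitMulTriangle a e (y - j * x)

namespace IsDigit

variable {a : ℤ} {e x y : ℝ}

theorem zero (hy : 0 ≤ y) (hyx : y < x) : IsDigit a e x y 0 where
  le := by simpa using hy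
  lt := by simpa using hyx
  semi j hj hj' := by omega

theorem one (hxy : x ≤ y) (hyx : y < 2 * x) (h : IsUnitMulTriangle a e y) :
    IsDigit a e x y 1 where
  le := by simpa using hxy
  lt := by
    push_cast
    linarith
  semi j hj hj' := by
    obtain rfl : j = 0 := by omega
    simpa using h

theorem two (hxy : 2 * x ≤ y) (hyx : y < 3 * x) (h : IsUnitMulTriangle a e y)
    (h' : IsUnitMulTriangle a e (y - x)) : IsDigit a e x y 2 where
  le := by exact_mod_cast hxy
  lt := by
    push_cast
    linarith
  semi j hj hj' := by
    obtain rfl | rfl : j = 0 ∨ j = 1 := by omega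
    · simpa using h
    · simpa using h'

theorem three (hxy : 3 * x ≤ y) (hyx : y < 4 * x) (h : IsUnitMulTriangle a e y)
    (h' : IsUnitMulTriangle a e (y - x)) (h'' : IsUnitMulTriangle a e (y - 2 * x)) :
    IsDigit a e x y 3 where
  le := by exact_mod_cast hxy
  lt := by
    push_cast
    linarith
  semi j hj hj' := by
    obtain rfl | rfl | rfl : j = 0 ∨ j = 1 ∨ j = 2 := by omega
    · simpa using h
    · simpa using h'
    · exact_mod_cast h''

theorem unit_mul {b : ℤ} (h : IsDigit a e x y b) (he : 0 < e) {u : ℝ} (hu : u ∈ rootUnits e) :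
    IsDigit a e (u * x) (u * y) b where
  le := by
    have := mul_le_mul_of_nonneg_left h.le (pos_of_mem_rootUnits he hu).le
    linarith
  lt := by
    have := mul_lt_mul_of_pos_left h.lt (pos_of_mem_rootUnits he hu)
    linarith
  semi j hj hjb := by
    convert (h.semi j hj hjb).unit_mul hu using 1
    ring

theorem floor_eq {b : ℤ} (h : IsDigit a e x y b) (hx : 0 < x) : ⌊y / x⌋ = b :=
  Int.floor_eq_iff.2 ⟨(le_div_iff₀ hx).2 h.le, (div_lt_iff₀ hx).2 h.lt⟩

end IsDigit

/-- One Jacobi–Perron step with digits `b` and `c` leads from `(x, y, z)` to a unit multiple of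
`(x', y', z')`, and its semiconvergents are unit multiples of triangle elements. -/
structure IsUnitStep (a : ℤ) (e x y z : ℝ) (b c : ℤ) (x' y' z' : ℝ) : Prop where
  pos : 0 < x
  fst : IsDigit a e x y b
  snd : IsDigit a e x z c
  next : ∃ u ∈ rootUnits e, y - b * x = u * x' ∧ z - c * x = u * y' ∧ x = u * z'

/-- The vectors met in the expansion of `(1, -ρ', ρ'²) = (1, 1 + e, (1 + e)²)`, up to units.
The path taken depends on `a`; in `lateLarge`, `m` and `p` are the quotient and the remainder of `a`
by `2`, and `addCube` and `subCube` are then met for `k = m + p + 3`. -/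
inductive IsExpansionTriple (a : ℤ) (e : ℝ) : ℝ → ℝ → ℝ → Prop
  | start : IsExpansionTriple a e 1 (1 + e) ((1 + e) ^ 2)
  | negOneFst (ha : a = -1) : IsExpansionTriple a e e (e / (1 + e) ^ 2) 1
  | negOneSnd (ha : a = -1) : IsExpansionTriple a e 1 e ((1 + e) ^ 2)
  | zero (ha : a = 0) : IsExpansionTriple a e e (e / (1 + e)) 1
  | second (ha : 1 ≤ a) : IsExpansionTriple a e e (2 * e + e ^ 2) 1
  | sq (ha : 0 ≤ a) : IsExpansionTriple a e (e ^ 2) (1 - (a + 1) * e) e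
  | one (ha : 0 ≤ a) : IsExpansionTriple a e 1 (2 * e + e ^ 2) (1 + e)
  | mid (ha : 1 ≤ a) : IsExpansionTriple a e (2 * e + e ^ 2) e 1
  | lateSmall (ha : 1 ≤ a) :
      IsExpansionTriple a e e (1 - (2 * e + e ^ 2)) (2 * e + e ^ 2)
  | lateLarge {m p : ℤ} (hm : 2 ≤ m) (hp : 0 ≤ p) (ha : a = 2 * m + p) :
      IsExpansionTriple a e e (1 - m * (2 * e + e ^ 2)) (2 * e + e ^ 2)
  | addCube {k : ℤ} (hak : a + 3 ≤ 2 * k) (hka : k ≤ a + 1) :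
      IsExpansionTriple a e (k * e ^ 2 + e ^ 3) (e ^ 2) e
  | subCube {k : ℤ} (hk : 1 ≤ k) (hka : k ≤ a + 1) :
      IsExpansionTriple a e (e ^ 2) (e - (k * e ^ 2 + e ^ 3)) (k * e ^ 2 + e ^ 3)
  | back (ha : 0 ≤ a) : IsExpansionTriple a e (e / (1 + e)) e 1

namespace IsInvRoot

section NegOne

variable {e : ℝ}

theorem inv_eq (H : IsInvRoot (-1) e) : e⁻¹ = (1 + e) ^ 2 - 2 := by
  have he := H.pos
  have R := H.rel
  push_cast at R
  field_simp
  linear_combination -R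

theorem div_sq_eq (H : IsInvRoot (-1) e) : e / (1 + e) ^ 2 = (1 + e) ^ 2 - 3 := by
  have he := H.pos
  have R := H.rel
  push_cast at R
  field_simp
  linear_combination (-2 - e) * R

theorem isDigit_one_sq_negOne (H : IsInvRoot (-1) e) :
    IsDigit (-1) e 1 ((1 + e) ^ 2) 3 := by
  have he1 : e < 1 := H.lt_one le_rfl
  have hpos : 0 < e / (1 + e) ^ 2 := by
    have := H.pos
    positivity
  rw [H.div_sq_eq] at hpos
  refine .three (by linarith) (by nlinarith [H.pos])
    (.of_mem (pow_mem (one_add_mem_rootUnits e) 2)) ?_ ?_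
  · convert H.isUnitMulTriangle_two_mul_add_sq le_rfl using 1
    ring
  · rw [mul_one, ← H.inv_eq]
    exact .of_mem (inv_mem_rootUnits e)

theorem isUnitStep_start_negOne (H : IsInvRoot (-1) e) :
    IsUnitStep (-1) e 1 (1 + e) ((1 + e) ^ 2) 1 3 e (e / (1 + e) ^ 2) 1 where
  pos := one_pos
  fst := .one (by linarith [H.pos]) (by linarith [H.lt_one le_rfl])
    (.of_mem (one_add_mem_rootUnits e))
  snd := H.isDigit_one_sq_negOne
  next := ⟨1, one_mem _, by simp, by simp [H.div_sq_eq], by simp⟩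

theorem isUnitStep_negOneFst (H : IsInvRoot (-1) e) :
    IsUnitStep (-1) e e (e / (1 + e) ^ 2) 1 0 1 1 e ((1 + e) ^ 2) where
  pos := H.pos
  fst := by
    have := H.pos
    exact .zero (by positivity) (_root_.div_lt_self this (by nlinarith))
  snd := by
    have he1 := H.lt_one le_rfl
    have hinv : e⁻¹ < 2 := by
      rw [H.inv_eq]
      nlinarith [H.pos]
    exact .one he1.le ((inv_lt_iff_one_lt_mul₀ H.pos).1 hinv) .one
  next := by
    have he := H.pos
    have hsub : 1 - e = e / (1 + e) ^ 2 * e := by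
      rw [H.div_sq_eq]
      linear_combination H.inv_eq * e - inv_mul_cancel₀ he.ne'
    refine ⟨e / (1 + e) ^ 2, ?_, by simp, by simpa using hsub, by field_simp⟩
    rw [pow_two, ← div_div, div_eq_mul_inv]
    exact mul_mem (div_one_add_mem_rootUnits e) (inv_one_add_mem_rootUnits e)

theorem isUnitStep_negOneSnd (H : IsInvRoot (-1) e) :
    IsUnitStep (-1) e 1 e ((1 + e) ^ 2) 0 3 e (e / (1 + e) ^ 2) 1 where
  pos := one_pos
  fst := .zero H.pos.le (H.lt_one le_rfl)
  snd := H.isDigit_one_sq_negOne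
  next := ⟨1, one_mem _, by simp, by simp [H.div_sq_eq], by simp⟩

end NegOne

section Zero

variable {e : ℝ}

theorem div_eq_zero (H : IsInvRoot 0 e) : e / (1 + e) = 2 * e + e ^ 2 - 1 := by
  simpa using H.div_eq

theorem isDigit_one_zero (H : IsInvRoot 0 e) : IsDigit 0 e 1 (2 * e + e ^ 2) 1 := by
  have hw := H.div_eq_zero
  exact .one (by linarith [H.div_pos]) (by linarith [H.div_lt_self, H.lt_one (by norm_num)])
    (H.isUnitMulTriangle_two_mul_add_sq (by norm_num))

theorem isUnitStep_start_zero (H : IsInvRoot 0 e) :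
    IsUnitStep 0 e 1 (1 + e) ((1 + e) ^ 2) 1 2 e (e / (1 + e)) 1 where
  pos := one_pos
  fst := .one (by linarith [H.pos]) (by linarith [H.lt_one (by norm_num)])
    (.of_mem (one_add_mem_rootUnits e))
  snd := by
    have hle := H.isDigit_one_zero.le
    have hlt := H.isDigit_one_zero.lt
    push_cast at hle hlt
    refine .two (by linarith) (by linarith)
      (.of_mem (pow_mem (one_add_mem_rootUnits e) 2)) ?_
    convert H.isUnitMulTriangle_two_mul_add_sq (by norm_num) using 1
    ring
  next := by
    refine ⟨1, one_mem _, by simp, ?_, by simp⟩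
    rw [H.div_eq_zero]
    push_cast
    ring

theorem isUnitStep_zero (H : IsInvRoot 0 e) :
    IsUnitStep 0 e e (e / (1 + e)) 1 0 1 1 (2 * e + e ^ 2) (1 + e) where
  pos := H.pos
  fst := .zero H.div_pos.le H.div_lt_self
  snd := .one (H.lt_one (by norm_num)).le (by simpa using H.one_lt_add_two_mul le_rfl) .one
  next := by
    have he := H.pos
    have R := H.rel
    refine ⟨_, div_one_add_mem_rootUnits e, by simp, ?_, by field_simp⟩
    push_cast at R ⊢
    field_simp
    linear_combination -R

theorem isUnitStep_one_zero (H : IsInvRoot 0 e) :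
    IsUnitStep 0 e 1 (2 * e + e ^ 2) (1 + e) 1 1 (e / (1 + e)) e 1 where
  pos := one_pos
  fst := H.isDigit_one_zero
  snd := .one (by linarith [H.pos]) (by linarith [H.lt_one (by norm_num)])
    (.of_mem (one_add_mem_rootUnits e))
  next := ⟨1, one_mem _, by simp [H.div_eq_zero], by simp, by simp⟩

end Zero

section NonNeg

variable {a : ℤ} {e : ℝ}

theorem isDigit_self_one (H : IsInvRoot a e) (ha : 0 ≤ a) : IsDigit a e e 1 (a + 1) where
  le := by
    push_cast
    nlinarith [H.add_one_mul_lt]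
  lt := by
    push_cast
    linarith [H.one_lt_add_two_mul ha]
  semi j hj hja := H.isUnitMulTriangle_one_sub_mul hj (by omega)

theorem isUnitStep_sq (H : IsInvRoot a e) (ha : 0 ≤ a) :
    IsUnitStep a e (e ^ 2) (1 - (a + 1) * e) e 1 (a + 1) 1 (2 * e + e ^ 2) (1 + e) where
  pos := pow_pos H.pos 2
  fst := by
    have hew : e * (e / (1 + e)) < e * e := mul_lt_mul_of_pos_left H.div_lt_self H.pos
    exact .one (by linarith [H.add_one_mul_lt]) (by linarith [H.one_eq])
      (H.isUnitMulTriangle_one_sub_add_one_mul (by omega))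
  snd := by
    simpa [pow_two] using (H.isDigit_self_one ha).unit_mul H.pos (self_mem_rootUnits e)
  next := by
    have he := H.pos
    refine ⟨e * (e / (1 + e)), mul_mem (self_mem_rootUnits e) (div_one_add_mem_rootUnits e),
      ?_, ?_, by field_simp⟩
    · push_cast
      linear_combination H.one_eq
    · push_cast
      linear_combination e * H.one_eq + e ^ 2 * H.sub_div

theorem isUnitStep_back (H : IsInvRoot a e) (ha : 0 ≤ a) :
    IsUnitStep a e (e / (1 + e)) e 1 1 (a + 2) (e ^ 2) (1 - (a + 1) * e) e where
  pos := H.div_pos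
  fst := by
    have hew : e * (e / (1 + e)) < 1 * (e / (1 + e)) :=
      mul_lt_mul_of_pos_right (H.lt_one (by omega)) H.div_pos
    exact .one H.div_lt_self.le (by linarith [H.sub_div]) (.of_mem (self_mem_rootUnits e))
  snd := by
    have he := H.pos
    have hd := H.isDigit_self_one ha
    have hle := hd.le
    have hlt := hd.lt
    push_cast at hle hlt
    refine ⟨?_, ?_, fun j hj hja => ?_⟩
    · rw [← mul_div_assoc, div_le_iff₀ (by positivity)]
      push_cast
      linarith
    · rw [← mul_div_assoc, lt_div_iff₀ (by positivity)]
      push_cast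
      linarith
    · rcases hj.eq_or_lt with rfl | hj
      · simpa using IsUnitMulTriangle.one
      · convert (hd.semi (j - 1) (by omega) (by omega)).unit_mul (inv_one_add_mem_rootUnits e)
          using 1
        push_cast
        field_simp
        ring
  next := by
    have he := H.pos
    refine ⟨_, inv_one_add_mem_rootUnits e, ?_, ?_, by field_simp⟩
    all_goals
      push_cast
      field_simp
      ring

theorem isUnitStep_addCube (H : IsInvRoot a e) {k : ℤ} (hak : a + 3 ≤ 2 * k) (hka : k ≤ a + 1) :
    IsUnitStep a e (k * e ^ 2 + e ^ 3) (e ^ 2) e 0 1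
      (e ^ 2) (e - (k * e ^ 2 + e ^ 3)) (k * e ^ 2 + e ^ 3) := by
  have he := H.pos
  have hk' : (1 : ℝ) ≤ k := by exact_mod_cast (by omega : 1 ≤ k)
  have hak' : (a + 3 : ℝ) ≤ 2 * k := by exact_mod_cast hak
  have hka' : (k : ℝ) ≤ a + 1 := by exact_mod_cast hka
  have hmul : k * e ^ 2 + e ^ 3 = e * (k * e + e ^ 2) := by ring
  exact
  { pos := by positivity
    fst := .zero (by positivity) (by nlinarith [pow_pos he 3, pow_pos he 2])
    snd := by
      have hle : k * e + e ^ 2 ≤ 1 := by nlinarith [H.add_one_mul_lt]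
      have hlt : 1 < 2 * (k * e + e ^ 2) := by nlinarith [H.one_lt_add_two_mul (by omega)]
      refine .one ?_ ?_ (.of_mem (self_mem_rootUnits e))
      · rw [hmul]
        exact mul_le_of_le_one_right he.le hle
      · rw [hmul]
        nlinarith
    next := ⟨1, one_mem _, by simp, by simp, by simp⟩ }

theorem isUnitStep_subCube (H : IsInvRoot a e) {k : ℤ} (hk : 1 ≤ k) (hka : k ≤ a + 1) :
    IsUnitStep a e (e ^ 2) (e - (k * e ^ 2 + e ^ 3)) (k * e ^ 2 + e ^ 3) (a + 1 - k) k
      (e / (1 + e)) e 1 := by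
  have hu := pow_mem (self_mem_rootUnits e) 2
  have hy : e - (k * e ^ 2 + e ^ 3) = e ^ 2 * ((a + 1 - k : ℤ) + e / (1 + e)) := by
    push_cast
    linear_combination e * H.one_eq
  have hz : k * e ^ 2 + e ^ 3 = e ^ 2 * (k + e) := by ring
  have hw := H.div_pos
  have hwe := H.div_lt_self
  have he1 := H.lt_one (by omega)
  have hdigit {n : ℤ} {x : ℝ} (hx : 0 < x) (hx1 : x < 1)
      (h : ∀ i : ℤ, 1 ≤ i → i ≤ n → IsUnitMulTriangle a e (i + x)) :
      IsDigit a e (e ^ 2) (e ^ 2 * (n + x)) n := by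
    have hn : IsDigit a e 1 (n + x) n := by
      refine ⟨by linarith, by linarith, fun j hj hjn => ?_⟩
      convert h (n - j) (by omega) (by omega) using 1
      push_cast
      ring
    simpa using hn.unit_mul H.pos hu
  exact
  { pos := pow_pos H.pos 2
    fst := hy ▸ hdigit hw (hwe.trans he1)
      fun i hi hin => H.isUnitMulTriangle_add_div hi (by omega)
    snd := hz ▸ hdigit H.pos he1 fun i hi hin => H.isUnitMulTriangle_add_self hi (by omega)
    next := ⟨e ^ 2, hu, by rw [hy]; ring, by ring, by ring⟩ }

end NonNeg

section Pos

variable {a : ℤ} {e : ℝ}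

theorem isDigit_self_two_mul_add_sq (H : IsInvRoot a e) (ha : -1 ≤ a) :
    IsDigit a e e (2 * e + e ^ 2) 2 := by
  have he := H.pos
  refine .two (by nlinarith) (by nlinarith [H.lt_one ha])
    (H.isUnitMulTriangle_two_mul_add_sq ha) ?_
  convert isUnitMulTriangle_add_sq using 1
  ring

theorem isUnitStep_start (H : IsInvRoot a e) (ha : 1 ≤ a) :
    IsUnitStep a e 1 (1 + e) ((1 + e) ^ 2) 1 1 e (2 * e + e ^ 2) 1 where
  pos := one_pos
  fst := .one (by linarith [H.pos]) (by linarith [H.lt_one (by omega)])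
    (.of_mem (one_add_mem_rootUnits e))
  snd := .one (by nlinarith [H.pos]) (by linarith [H.two_mul_add_sq_lt_one ha])
    (.of_mem (pow_mem (one_add_mem_rootUnits e) 2))
  next := ⟨1, one_mem _, by simp, by push_cast; ring, by simp⟩

theorem isUnitStep_second (H : IsInvRoot a e) (ha : 1 ≤ a) :
    IsUnitStep a e e (2 * e + e ^ 2) 1 2 (a + 1) (e ^ 2) (1 - (a + 1) * e) e where
  pos := H.pos
  fst := H.isDigit_self_two_mul_add_sq (by omega)
  snd := H.isDigit_self_one (by omega)
  next := ⟨1, one_mem _, by push_cast; ring, by simp, by simp⟩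

theorem isUnitStep_one (H : IsInvRoot a e) (ha : 1 ≤ a) :
    IsUnitStep a e 1 (2 * e + e ^ 2) (1 + e) 0 1 (2 * e + e ^ 2) e 1 where
  pos := one_pos
  fst := .zero (by nlinarith [H.pos]) (H.two_mul_add_sq_lt_one ha)
  snd := .one (by linarith [H.pos]) (by linarith [H.lt_one (by omega)])
    (.of_mem (one_add_mem_rootUnits e))
  next := ⟨1, one_mem _, by simp, by simp, by simp⟩

theorem isUnitStep_mid_small (H : IsInvRoot a e) (ha : 1 ≤ a) (ha3 : a ≤ 3) :
    IsUnitStep a e (2 * e + e ^ 2) e 1 0 1 e (1 - (2 * e + e ^ 2)) (2 * e + e ^ 2) where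
  pos := by nlinarith [H.pos]
  fst := .zero H.pos.le (by nlinarith [H.pos])
  snd := by
    have he := H.pos
    have ha' : a * e ≤ 3 * e := mul_le_mul_of_nonneg_right (by exact_mod_cast ha3) he.le
    have hew : e * (e / (1 + e)) < e * e := mul_lt_mul_of_pos_left H.div_lt_self he
    exact .one (H.two_mul_add_sq_lt_one ha).le (by linarith [H.one_eq]) .one
  next := ⟨1, one_mem _, by simp, by simp, by simp⟩

theorem isUnitStep_lateSmall (H : IsInvRoot a e) (ha : 1 ≤ a) :
    IsUnitStep a e e (1 - (2 * e + e ^ 2)) (2 * e + e ^ 2) (a - 1) 2 (e / (1 + e)) e 1 := by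
  have hrest : 1 - (2 * e + e ^ 2) = (a - 1) * e + e * (e / (1 + e)) := by
    linear_combination H.one_eq
  have hew : e * (e / (1 + e)) < e :=
    mul_lt_of_lt_one_right H.pos (H.div_lt_self.trans (H.lt_one (by omega)))
  have hpos := mul_pos H.pos H.div_pos
  exact
  { pos := H.pos
    fst := by
      refine ⟨?_, ?_, fun i hi hia => ?_⟩
      · push_cast
        linarith
      · push_cast
        linarith
      · simpa using
          H.isUnitMulTriangle_one_sub_mul_sub (j := 1) le_rfl hi (by omega)
    snd := H.isDigit_self_two_mul_add_sq (by omega)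
    next := by
      refine ⟨e, self_mem_rootUnits e, ?_, by push_cast; ring, by simp⟩
      push_cast
      linear_combination hrest }

theorem isUnitStep_mid_large (H : IsInvRoot a e) {m p : ℤ} (hm : 2 ≤ m) (hp : 0 ≤ p) (hp1 : p ≤ 1)
    (ha : a = 2 * m + p) :
    IsUnitStep a e (2 * e + e ^ 2) e 1 0 m e (1 - m * (2 * e + e ^ 2)) (2 * e + e ^ 2) := by
  have he := H.pos
  have ha' : (a : ℝ) = 2 * m + p := by exact_mod_cast ha
  have hm' : (2 : ℝ) ≤ m := by exact_mod_cast hm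
  have hp' : (0 : ℝ) ≤ p := by exact_mod_cast hp
  have hp1' : (p : ℝ) ≤ 1 := by exact_mod_cast hp1
  have hone := H.one_eq
  have hew : e * (e / (1 + e)) < e * e := mul_lt_mul_of_pos_left H.div_lt_self he
  rw [ha'] at hone
  exact
  { pos := by positivity
    fst := .zero he.le (by nlinarith)
    snd := by
      refine ⟨?_, ?_, fun j hj hjm => ?_⟩
      · have hme : m * e < 1 := by nlinarith [mul_pos he H.div_pos]
        nlinarith [mul_pos he H.div_pos]
      · nlinarith [mul_pos he he]
      · rcases hj.eq_or_lt with rfl | hj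
        · simpa using IsUnitMulTriangle.one
        · simpa using H.isUnitMulTriangle_one_sub_mul_sub (i := 0) hj le_rfl (by omega)
    next := ⟨1, one_mem _, by simp, by simp, by simp⟩ }

theorem isUnitStep_lateLarge (H : IsInvRoot a e) {m p : ℤ} (hm : 2 ≤ m) (hp : 0 ≤ p)
    (ha : a = 2 * m + p) :
    IsUnitStep a e e (1 - m * (2 * e + e ^ 2)) (2 * e + e ^ 2) p 2
      ((m + p + 3 : ℤ) * e ^ 2 + e ^ 3) (e ^ 2) e := by
  have he := H.pos
  have ha' : (a : ℝ) = 2 * m + p := by exact_mod_cast ha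
  have hm' : (2 : ℝ) ≤ m := by exact_mod_cast hm
  have hp' : (0 : ℝ) ≤ p := by exact_mod_cast hp
  have hone := H.one_eq
  have hew : e * (e / (1 + e)) < e * e := mul_lt_mul_of_pos_left H.div_lt_self he
  rw [ha'] at hone
  exact
  { pos := he
    fst := by
      refine ⟨?_, ?_, fun i hi hip => ?_⟩
      · have hme : m * e < 1 := by nlinarith [mul_pos he H.div_pos]
        nlinarith [mul_pos he H.div_pos]
      · nlinarith [mul_pos he he]
      · exact H.isUnitMulTriangle_one_sub_mul_sub (by omega) hi (by omega)
    snd := H.isDigit_self_two_mul_add_sq (by omega)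
    next := by
      have R := H.rel
      rw [ha'] at R
      refine ⟨1, one_mem _, ?_, by push_cast; ring, by simp⟩
      push_cast
      linear_combination -R }

end Pos

end IsInvRoot

theorem IsExpansionTriple.exists_step {a : ℤ} {e x y z : ℝ} (H : IsInvRoot a e) (ha : -1 ≤ a)
    (h : IsExpansionTriple a e x y z) :
    ∃ b c x' y' z', IsExpansionTriple a e x' y' z' ∧ IsUnitStep a e x y z b c x' y' z' := by
  cases h with
  | start =>
    obtain rfl | rfl | ha : a = -1 ∨ a = 0 ∨ 1 ≤ a := by omega
    · exact ⟨_, _, _, _, _, .negOneFst rfl, H.isUnitStep_start_negOne⟩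
    · exact ⟨_, _, _, _, _, .zero rfl, H.isUnitStep_start_zero⟩
    · exact ⟨_, _, _, _, _, .second ha, H.isUnitStep_start ha⟩
  | negOneFst ha =>
    subst ha
    exact ⟨_, _, _, _, _, .negOneSnd rfl, H.isUnitStep_negOneFst⟩
  | negOneSnd ha =>
    subst ha
    exact ⟨_, _, _, _, _, .negOneFst rfl, H.isUnitStep_negOneSnd⟩
  | zero ha =>
    subst ha
    exact ⟨_, _, _, _, _, .one le_rfl, H.isUnitStep_zero⟩
  | second ha => exact ⟨_, _, _, _, _, .sq (by omega), H.isUnitStep_second ha⟩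
  | sq ha => exact ⟨_, _, _, _, _, .one ha, H.isUnitStep_sq ha⟩
  | one ha =>
    obtain rfl | ha : a = 0 ∨ 1 ≤ a := by omega
    · exact ⟨_, _, _, _, _, .back le_rfl, H.isUnitStep_one_zero⟩
    · exact ⟨_, _, _, _, _, .mid ha, H.isUnitStep_one ha⟩
  | mid ha =>
    rcases le_or_gt a 3 with ha3 | ha3
    · exact ⟨_, _, _, _, _, .lateSmall ha, H.isUnitStep_mid_small ha ha3⟩
    · have hm : 2 ≤ a / 2 := by omega
      have ha2 : a = 2 * (a / 2) + a % 2 := by omega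
      exact ⟨_, _, _, _, _, .lateLarge hm (by omega) ha2,
        H.isUnitStep_mid_large hm (by omega) (by omega) ha2⟩
  | lateSmall ha => exact ⟨_, _, _, _, _, .back (by omega), H.isUnitStep_lateSmall ha⟩
  | lateLarge hm hp ha2 =>
    exact ⟨_, _, _, _, _, .addCube (by omega) (by omega), H.isUnitStep_lateLarge hm hp ha2⟩
  | addCube hak hka =>
    exact ⟨_, _, _, _, _, .subCube (by omega) hka, H.isUnitStep_addCube hak hka⟩
  | subCube hk hka => exact ⟨_, _, _, _, _, .back (by omega), H.isUnitStep_subCube hk hka⟩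
  | back ha => exact ⟨_, _, _, _, _, .sq ha, H.isUnitStep_back ha⟩

theorem IsInvRoot.isUnitMulTriangle_of_isSemiconvergent {a : ℤ} {e δ : ℝ} (H : IsInvRoot a e)
    (ha : -1 ≤ a) (hδ : IsSemiconvergent ![1, 1 + e, (1 + e) ^ 2] δ) :
    IsUnitMulTriangle a e δ := by
  let V : Set (Fin 3 → ℝ) :=
    {β | ∃ u ∈ rootUnits e, ∃ x y z, IsExpansionTriple a e x y z ∧ β = u • ![x, y, z]}
  refine hδ.of_invariant (V := V) ?_ ?_ ⟨1, one_mem _, _, _, _, .start, (one_smul ℝ _).symm⟩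
  · rintro _ ⟨u, hu, x, y, z, h, rfl⟩
    obtain ⟨b, c, x', y', z', h', hs⟩ := h.exists_step H ha
    obtain ⟨u', hu', hx', hy', hz'⟩ := hs.next
    refine ⟨u * u', mul_mem hu hu', x', y', z', h', ?_⟩
    rw [jpaStep_smul (pos_of_mem_rootUnits H.pos hu).ne', jpaStep_vec3, hs.fst.floor_eq hs.pos,
      hs.snd.floor_eq hs.pos, hx', hy', hz', mul_smul]
    simp
  · rintro _ ⟨u, hu, x, y, z, h, rfl⟩ i j hj
    obtain ⟨b, c, x', y', z', -, hs⟩ := h.exists_step H ha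
    have hu0 := (pos_of_mem_rootUnits H.pos hu).ne'
    have hcoord : ∀ {y b}, IsDigit a e x y b → (j : ℤ) < ⌊u * y / (u * x)⌋ →
        IsUnitMulTriangle a e (u * y - j * (u * x)) := by
      intro y b hd hj
      rw [mul_div_mul_left _ _ hu0, hd.floor_eq hs.pos] at hj
      convert (hd.semi j (by omega) hj).unit_mul hu using 1
      push_cast
      ring
    fin_cases i
    · exact hcoord hs.fst hj
    · exact hcoord hs.snd hj

/-! ### Roots of the simplest cubic -/

open Polynomial in
/-- The simplest cubic polynomial `x³ - ax² - (a+3)x - 1`. -/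
noncomputable def simplestCubic (a : ℤ) : ℤ[X] :=
  X ^ 3 - C a * X ^ 2 - C (a + 3) * X - 1

/-- `x` is a root of the simplest cubic `x³ - ax² - (a+3)x - 1`. -/
def IsSimplestCubicRoot {R : Type*} [CommRing R] (a : ℤ) (x : R) : Prop :=
  x ^ 3 - a * x ^ 2 - (a + 3) * x - 1 = 0

/-- The conjugate `-1 - 1/x` of a root `x` of the simplest cubic, written as a polynomial in `x`.
It generates the Galois action on the roots and sends `ρ` to `ρ'`. -/
def simplestConj {R : Type*} [CommRing R] (a : ℤ) (x : R) : R :=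
  a + 2 + a * x - x ^ 2

section Polynomial

open Polynomial

variable (a : ℤ)

theorem simplestCubic_monic : (simplestCubic a).Monic := by
  unfold simplestCubic
  monicity!

theorem simplestCubic_natDegree : (simplestCubic a).natDegree = 3 := by
  unfold simplestCubic
  compute_degree!

variable {a}

theorem aeval_simplestCubic_eq_zero_iff {R : Type*} [CommRing R] {x : R} :
    aeval x (simplestCubic a) = 0 ↔ IsSimplestCubicRoot a x := by
  have h3 : aeval x (3 : ℤ[X]) = 3 := map_ofNat _ 3
  simp [simplestCubic, IsSimplestCubicRoot, h3]

variable (a)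

theorem simplestCubic_map_irreducible : Irreducible ((simplestCubic a).map (algebraMap ℤ ℚ)) := by
  have hm := simplestCubic_monic a
  have hd := simplestCubic_natDegree a
  rw [← hm.irreducible_iff_irreducible_map_fraction_map,
    hm.irreducible_iff_roots_eq_zero_of_degree_le_three (by omega) (by omega)]
  refine Multiset.eq_zero_of_forall_notMem fun n hn => ?_
  have h : n ^ 3 - a * n ^ 2 - (a + 3) * n - 1 = 0 := by
    simpa [simplestCubic] using (mem_roots'.1 hn).2
  have hu : n * (n ^ 2 - a * n - (a + 3)) = 1 := by linear_combination h
  rcases Int.eq_one_or_neg_one_of_mul_eq_one hu with rfl | rfl <;> omega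

end Polynomial

namespace IsSimplestCubicRoot

variable {R S : Type*} [CommRing R] [CommRing S] {a : ℤ} {x : R}

theorem isUnit (hx : IsSimplestCubicRoot a x) : IsUnit x :=
  .of_mul_eq_one (x ^ 2 - a * x - (a + 3)) <| by
    unfold IsSimplestCubicRoot at hx
    linear_combination hx

theorem map (hx : IsSimplestCubicRoot a x) (f : R →+* S) : IsSimplestCubicRoot a (f x) := by
  have h3 : f 3 = 3 := map_ofNat f 3
  simpa [IsSimplestCubicRoot, h3] using congrArg f hx

theorem of_map {f : R →+* S} (hf : Function.Injective f) (hx : IsSimplestCubicRoot a (f x)) :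
    IsSimplestCubicRoot a x := by
  have h3 : f 3 = 3 := map_ofNat f 3
  rw [IsSimplestCubicRoot] at hx ⊢
  exact hf (by simpa [h3] using hx)

theorem conj (hx : IsSimplestCubicRoot a x) : IsSimplestCubicRoot a (simplestConj a x) := by
  unfold IsSimplestCubicRoot simplestConj at *
  linear_combination (-x ^ 3 + 2 * a * x ^ 2 + (-a ^ 2 + a + 3) * x - a ^ 2 - 3 * a - 1) * hx

theorem mul_one_add_conj (hx : IsSimplestCubicRoot a x) : x * (1 + simplestConj a x) = -1 := by
  unfold IsSimplestCubicRoot simplestConj at *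
  linear_combination -hx

theorem conj_conj_conj (hx : IsSimplestCubicRoot a x) :
    simplestConj a (simplestConj a (simplestConj a x)) = x := by
  have h := hx.mul_one_add_conj
  have h' := hx.conj.mul_one_add_conj
  have h'' := hx.conj.conj.mul_one_add_conj
  set y := simplestConj a x
  set z := simplestConj a y
  have hz : z * (1 + x) = -1 := by linear_combination (1 + z) * h - x * h'
  refine hx.conj.conj.isUnit.mul_left_cancel ?_
  linear_combination h'' - hz

theorem conj_eq {K : Type*} [Field K] {x : K} (hx : IsSimplestCubicRoot a x) :
    simplestConj a x = -(1 + x⁻¹) := by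
  have := hx.isUnit.ne_zero
  field_simp
  linear_combination hx.mul_one_add_conj

open Polynomial in
theorem exists_eq_of_mem_adjoin (hx : IsSimplestCubicRoot a x) {y : R}
    (hy : y ∈ Algebra.adjoin ℤ {x}) : ∃ p q r : ℤ, y = p + q * x + r * x ^ 2 := by
  rw [Algebra.adjoin_singleton_eq_range_aeval] at hy
  obtain ⟨f, rfl⟩ := hy
  have hm := simplestCubic_monic a
  set g := f %ₘ simplestCubic a
  have hdeg : g.natDegree < 3 := by
    rw [← simplestCubic_natDegree a]
    exact natDegree_modByMonic_lt f hm fun h => by simpa [h] using simplestCubic_natDegree a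
  have hfg : aeval x f = aeval x g :=
    (aeval_modByMonic_eq_self_of_root (aeval_simplestCubic_eq_zero_iff.2 hx)).symm
  refine ⟨g.coeff 0, g.coeff 1, g.coeff 2, ?_⟩
  change aeval x f = _
  rw [hfg, aeval_eq_sum_range' hdeg]
  simp [Finset.sum_range_succ]

end IsSimplestCubicRoot

theorem map_simplestConj {R S : Type*} [CommRing R] [CommRing S] (f : R →+* S) (a : ℤ) (x : R) :
    f (simplestConj a x) = simplestConj a (f x) := by
  have h2 : f 2 = 2 := map_ofNat f 2
  simp [simplestConj, h2]

theorem simplestConj_mem {R : Type*} [CommRing R] {O : Subalgebra ℤ R} (a : ℤ) {x : R}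
    (hx : x ∈ O) : simplestConj a x ∈ O := by
  have ha : (a : R) ∈ O := intCast_mem O a
  exact sub_mem (add_mem (add_mem ha (ofNat_mem O 2)) (mul_mem ha hx)) (pow_mem hx 2)

theorem IsSimplestCubicRoot.adjoin_conj {R : Type*} [CommRing R] {a : ℤ} {x : R}
    (hx : IsSimplestCubicRoot a x) :
    Algebra.adjoin ℤ {simplestConj a x} = Algebra.adjoin ℤ {x} := by
  refine le_antisymm ?_ ?_ <;> rw [Algebra.adjoin_le_iff, Set.singleton_subset_iff]
  · exact simplestConj_mem a (Algebra.self_mem_adjoin_singleton ℤ x)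
  · have h := simplestConj_mem a (simplestConj_mem a
      (Algebra.self_mem_adjoin_singleton ℤ (simplestConj a x)))
    rwa [hx.conj_conj_conj] at h

/-! ### Real roots -/

theorem IsSimplestCubicRoot.isInvRoot {a : ℤ} {ρ : ℝ} (hρ : IsSimplestCubicRoot a ρ)
    (hρ0 : 0 < ρ) : IsInvRoot a ρ⁻¹ where
  pos := inv_pos.2 hρ0
  rel := by
    unfold IsSimplestCubicRoot at hρ
    field_simp
    linear_combination -hρ

namespace IsInvRoot

variable {a : ℤ} {e : ℝ}

theorem isSimplestCubicRoot_iff (H : IsInvRoot a e) {x : ℝ} :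
    IsSimplestCubicRoot a x ↔ x = e⁻¹ ∨ x = -(1 + e) ∨ x = -(e / (1 + e)) := by
  have he := H.pos
  have h : x ^ 3 - a * x ^ 2 - (a + 3) * x - 1 =
      (x - e⁻¹) * (x - -(1 + e)) * (x - -(e / (1 + e))) := by
    have ha : (a : ℝ) = (1 - 3 * e ^ 2 - e ^ 3) / (e * (1 + e)) := by
      field_simp
      linear_combination H.rel
    rw [ha]
    field_simp
    ring
  rw [IsSimplestCubicRoot, h, mul_eq_zero, mul_eq_zero, sub_eq_zero, sub_eq_zero, sub_eq_zero,
    or_assoc]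

theorem eq_neg_one_add_of_lt_neg_one (H : IsInvRoot a e) {x : ℝ} (hx : IsSimplestCubicRoot a x)
    (hx1 : x < -1) : x = -(1 + e) := by
  have he := H.pos
  rcases H.isSimplestCubicRoot_iff.1 hx with rfl | rfl | rfl
  · linarith [inv_pos.2 he]
  · rfl
  · have : e / (1 + e) < 1 := (div_lt_one (by positivity)).2 (by linarith)
    linarith

theorem triangleElement_pos (H : IsInvRoot a e) {v W : ℕ} (hv : (v : ℤ) ≤ a)
    (hW : (W : ℤ) ≤ a - v) {x : ℝ} (hx : IsSimplestCubicRoot a x) :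
    0 < triangleElement a v W x := by
  have he := H.pos
  have hw := H.div_pos
  have hv' : (v : ℝ) ≤ a := by exact_mod_cast hv
  have hW' : (W : ℝ) ≤ a - v := by exact_mod_cast hW
  rcases H.isSimplestCubicRoot_iff.1 hx with rfl | rfl | rfl
  · have h : triangleElement a v W e⁻¹ =
        ((a - v - W) * e + e ^ 2 + (v + 1) * (e * (e / (1 + e)))) / e ^ 2 := by
      rw [H.div_eq, triangleElement]
      field_simp
      linear_combination (-v - 1) * H.rel
    have : 0 ≤ a - v - (W : ℝ) := by linarith
    rw [h]
    positivity
  · have h : triangleElement a v W (-(1 + e)) =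
        v * ((a + 1) + (a + 2) * e) + (1 + W) * (1 + e) + (v + 1) * (1 + e) ^ 2 := by
      rw [triangleElement]
      ring
    have : (0 : ℝ) ≤ a := v.cast_nonneg.trans hv'
    rw [h]
    positivity
  · have h : triangleElement a v W (-(e / (1 + e))) =
        e / (1 + e) * (1 + W + e / (1 + e) - v * e) := by
      rw [triangleElement]
      field_simp
      linear_combination v * H.rel
    have hve : v * e < 1 := by nlinarith [H.add_one_mul_lt]
    rw [h]
    exact mul_pos hw (by linarith [W.cast_nonneg (α := ℝ)])

end IsInvRoot

/-! ### Indecomposability in orders -/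

section Indecomposable

variable {K : Type*} [Field K]

theorem signature_eq_totallyPositive {x : K} :
    signature x = totallyPositive K ↔ ∀ σ : K →+* ℝ, 0 < σ x := by
  simp [funext_iff, signature, totallyPositive, sign_eq_one_iff]

theorem signature_mul (x y : K) : signature (x * y) = signature x * signature y := by
  funext σ
  simp [signature, sign_mul]

namespace IsSIndecomposable

variable {O : Subalgebra ℤ K} {s : (K →+* ℝ) → SignType} {x : K}

theorem of_lt_two (hx : x ∈ O) (hs : signature x = s) (φ : K →+ ℝ)
    (hφ : ∀ y ∈ O, signature y = s → 1 ≤ φ y) (h : φ x < 2) : IsSIndecomposable O s x := by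
  refine ⟨⟨hx, hs⟩, ?_⟩
  rintro ⟨y, hy, z, hz, hys, hzs, rfl⟩
  rw [map_add] at h
  linarith [hφ y hy hys, hφ z hz hzs]

theorem unit_mul (h : IsSIndecomposable O s x) (ε : Oˣ) :
    IsSIndecomposable O (signature ((ε : O) * x : K)) ((ε : O) * x : K) := by
  obtain ⟨⟨hx, hs⟩, hind⟩ := h
  have hinv : (((ε⁻¹ : Oˣ) : O) : K) * (ε : O) = 1 := congrArg Subtype.val ε.inv_mul
  have hback : ∀ w : K, signature w = signature ((ε : O) * x : K) →
      signature (((ε⁻¹ : Oˣ) : O) * w : K) = s := fun w hw => by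
    rw [signature_mul, hw, ← signature_mul, ← mul_assoc, hinv, one_mul, hs]
  refine ⟨⟨mul_mem (ε : O).2 hx, rfl⟩, ?_⟩
  rintro ⟨y, hy, z, hz, hys, hzs, hyz⟩
  refine hind ⟨_, mul_mem ((ε⁻¹ : Oˣ) : O).2 hy, _, mul_mem ((ε⁻¹ : Oˣ) : O).2 hz,
    hback y hys, hback z hzs, ?_⟩
  rw [← mul_add, ← hyz, ← mul_assoc, hinv, one_mul]

end IsSIndecomposable

end Indecomposable

/-! ### The order `ℤ[ρ]` -/

namespace IsSimplestCubicRoot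

open IntermediateField

variable {a : ℤ} {ρ : ℝ}

open Polynomial in
theorem exists_embedding_gen (hρ : IsSimplestCubicRoot a ρ) {x : ℝ}
    (hx : IsSimplestCubicRoot a x) : ∃ σ : realField ρ →+* ℝ, σ (AdjoinSimple.gen ℚ ρ) = x := by
  set f := (simplestCubic a).map (algebraMap ℤ ℚ)
  have hm : f.Monic := (simplestCubic_monic a).map _
  have hroot : ∀ y : ℝ, IsSimplestCubicRoot a y → aeval y f = 0 := fun y hy => by
    rw [aeval_map_algebraMap]
    exact aeval_simplestCubic_eq_zero_iff.2 hy
  have hmin : minpoly ℚ ρ = f :=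
    (minpoly.eq_of_irreducible_of_monic (simplestCubic_map_irreducible a) (hroot ρ hρ) hm).symm
  have hint : IsIntegral ℚ ρ := ⟨f, hm, hroot ρ hρ⟩
  have hmem : x ∈ (minpoly ℚ ρ).aroots ℝ := by
    rw [hmin, mem_aroots]
    exact ⟨hm.ne_zero, hroot x hx⟩
  exact ⟨(algHomAdjoinIntegralEquiv ℚ hint).symm ⟨x, hmem⟩,
    algHomAdjoinIntegralEquiv_symm_apply_gen ℚ hint _⟩

theorem gen (hρ : IsSimplestCubicRoot a ρ) : IsSimplestCubicRoot a (AdjoinSimple.gen ℚ ρ) :=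
  of_map (f := algebraMap (realField ρ) ℝ) Subtype.val_injective hρ

theorem exists_embedding_conj_gen (hρ : IsSimplestCubicRoot a ρ) {x : ℝ}
    (hx : IsSimplestCubicRoot a x) :
    ∃ σ : realField ρ →+* ℝ, σ (simplestConj a (AdjoinSimple.gen ℚ ρ)) = x := by
  obtain ⟨σ, hσ⟩ := hρ.exists_embedding_gen hx.conj.conj
  exact ⟨σ, by rw [map_simplestConj, hσ, hx.conj_conj_conj]⟩

theorem exists_totallyPositive_functional (hρ : IsSimplestCubicRoot a ρ) (hρ0 : 0 < ρ) :
    ∃ φ : realField ρ →+ ℝ, (∀ x, (∀ σ : realField ρ →+* ℝ, 0 < σ x) → 0 < φ x) ∧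
      ∀ p q r : ℤ, φ (p + q * simplestConj a (AdjoinSimple.gen ℚ ρ) +
        r * simplestConj a (AdjoinSimple.gen ℚ ρ) ^ 2) = p + r := by
  have H := hρ.isInvRoot hρ0
  set e := ρ⁻¹
  have he := H.pos
  obtain ⟨σ₁, h₁⟩ :=
    hρ.exists_embedding_conj_gen (H.isSimplestCubicRoot_iff.2 (Or.inl rfl))
  obtain ⟨σ₂, h₂⟩ :=
    hρ.exists_embedding_conj_gen (H.isSimplestCubicRoot_iff.2 (Or.inr (Or.inl rfl)))
  obtain ⟨σ₃, h₃⟩ :=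
    hρ.exists_embedding_conj_gen (H.isSimplestCubicRoot_iff.2 (Or.inr (Or.inr rfl)))
  -- The weights solve the linear system `∑ cᵢ = 1`, `∑ cᵢ xᵢ = 0`, `∑ cᵢ xᵢ² = 1`
  -- for the three real roots `xᵢ`.
  set D := (1 + e + e ^ 2) ^ 2 with hD
  refine ⟨AddMonoidHom.mk' (fun x => (e ^ 2 * (1 + e) ^ 2 / D) * σ₁ x + (e ^ 2 / D) * σ₂ x +
    ((1 + e) ^ 2 / D) * σ₃ x) fun x y => by simp only [map_add]; ring, fun x hx => ?_,
    fun p q r => ?_⟩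
  · have := hx σ₁
    have := hx σ₂
    have := hx σ₃
    simp only [AddMonoidHom.mk'_apply]
    positivity
  · simp only [AddMonoidHom.mk'_apply, map_add, map_mul, map_pow, map_intCast, h₁, h₂, h₃, hD]
    field_simp
    ring

theorem exists_eq_of_mem_realOrder (hρ : IsSimplestCubicRoot a ρ) {y : realField ρ}
    (hy : y ∈ realOrder ρ) :
    ∃ p q r : ℤ, y = p + q * simplestConj a (AdjoinSimple.gen ℚ ρ) +
      r * simplestConj a (AdjoinSimple.gen ℚ ρ) ^ 2 :=
  hρ.gen.conj.exists_eq_of_mem_adjoin (by rwa [hρ.gen.adjoin_conj])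

theorem isSIndecomposable_of_add_eq_one (hρ : IsSimplestCubicRoot a ρ) (hρ0 : 0 < ρ) {p q r : ℤ}
    (hpr : p + r = 1)
    (hpos : ∀ x : ℝ, IsSimplestCubicRoot a x → 0 < p + q * x + r * x ^ 2) :
    IsSIndecomposable (realOrder ρ) (totallyPositive (realField ρ))
      (p + q * simplestConj a (AdjoinSimple.gen ℚ ρ) +
        r * simplestConj a (AdjoinSimple.gen ℚ ρ) ^ 2) := by
  have hconj : simplestConj a (AdjoinSimple.gen ℚ ρ) ∈ realOrder ρ :=
    simplestConj_mem a (Algebra.self_mem_adjoin_singleton ℤ _)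
  obtain ⟨φ, hφpos, hφ⟩ := hρ.exists_totallyPositive_functional hρ0
  refine .of_lt_two ?_ ?_ φ (fun y hy hys => ?_) ?_
  · exact add_mem (add_mem (intCast_mem _ p) (mul_mem (intCast_mem _ q) hconj))
      (mul_mem (intCast_mem _ r) (pow_mem hconj 2))
  · refine signature_eq_totallyPositive.2 fun σ => ?_
    simpa only [map_add, map_mul, map_pow, map_intCast] using hpos _ (hρ.gen.conj.map σ)
  · obtain ⟨p', q', r', rfl⟩ := hρ.exists_eq_of_mem_realOrder hy
    have h := hφpos _ (signature_eq_totallyPositive.1 hys)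
    rw [hφ] at h ⊢
    exact_mod_cast h
  · rw [hφ, (by exact_mod_cast hpr : (p : ℝ) + r = 1)]
    norm_num

theorem exists_isSIndecomposable_of_isOneOrTriangle (hρ : IsSimplestCubicRoot a ρ) (hρ0 : 0 < ρ)
    {α : ℝ} (hα : IsOneOrTriangle a (-(1 + ρ⁻¹)) α) :
    ∃ x : realField ρ, (x : ℝ) = α ∧
      IsSIndecomposable (realOrder ρ) (totallyPositive (realField ρ)) x := by
  obtain rfl | ⟨v, W, hv, hW, rfl⟩ := hα
  · exact ⟨1, rfl, by
      simpa using hρ.isSIndecomposable_of_add_eq_one hρ0 (p := 1) (q := 0) (r := 0) rfl (by simp)⟩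
  · refine ⟨_, ?_, hρ.isSIndecomposable_of_add_eq_one hρ0
      (p := -v) (q := -(v * (a + 2) + 1 + W)) (r := v + 1) (by ring) fun x hx => ?_⟩
    · have hconj : ((simplestConj a (AdjoinSimple.gen ℚ ρ) : realField ρ) : ℝ) = -(1 + ρ⁻¹) := by
        rw [← hρ.conj_eq]
        exact map_simplestConj (algebraMap (realField ρ) ℝ) a _
      have h2 : ((2 : realField ρ) : ℝ) = 2 := rfl
      rw [← hconj]
      simp [triangleElement, h2]
      ring
    · convert (hρ.isInvRoot hρ0).triangleElement_pos hv hW hx using 1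
      rw [triangleElement]
      push_cast
      ring

theorem exists_unit_of_mem_rootUnits (hρ : IsSimplestCubicRoot a ρ) {u : ℝ}
    (hu : u ∈ rootUnits ρ⁻¹) :
    ∃ ε : (realOrder ρ)ˣ, (((ε : realOrder ρ) : realField ρ) : ℝ) = u := by
  let f : (realOrder ρ)ˣ →* ℝˣ := Units.map (algebraMap (realOrder ρ) ℝ : realOrder ρ →* ℝ)
  let g : realOrder ρ := ⟨AdjoinSimple.gen ℚ ρ, Algebra.self_mem_adjoin_singleton ℤ _⟩
  have hg : IsSimplestCubicRoot a g :=
    of_map (f := algebraMap (realOrder ρ) (realField ρ)) Subtype.val_injective hρ.gen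
  obtain ⟨η, hη⟩ := hg.isUnit
  obtain ⟨θ, hθ⟩ := hg.conj.isUnit.neg
  have hfη : (f η : ℝ) = ρ := congrArg (algebraMap (realOrder ρ) ℝ) hη
  have hfθ : (f θ : ℝ) = 1 + ρ⁻¹ := by
    have h := congrArg (algebraMap (realOrder ρ) ℝ) hθ
    rw [map_neg, map_simplestConj] at h
    exact h.trans (neg_eq_iff_eq_neg.2 hρ.conj_eq)
  suffices h : rootUnits ρ⁻¹ ≤ MonoidHom.mrange ((Units.coeHom ℝ).comp f) from h hu
  refine Submonoid.closure_le.2 ?_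
  rintro _ (rfl | rfl | rfl | rfl)
  · exact ⟨η⁻¹, by simp [hfη]⟩
  · exact ⟨η, by simp [hfη]⟩
  · exact ⟨θ, hfθ⟩
  · exact ⟨θ⁻¹, by simp [hfθ]⟩

end IsSimplestCubicRoot

theorem theorem8p1 (a : ℤ) (ha : -1 ≤ a) (ρ ρ' : ℝ)
    (hρ : ρ ^ 3 - a * ρ ^ 2 - (a + 3) * ρ - 1 = 0) (hρ_gt : a + 1 < ρ)
    (hρ' : ρ' ^ 3 - a * ρ' ^ 2 - (a + 3) * ρ' - 1 = 0) (hρ'_gt : -2 < ρ') (hρ'_lt : ρ' < -1)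
    (δ : ℝ) (hδ : IsSemiconvergent ![1, -ρ', ρ' ^ 2] δ) :
    ∃ x : realField ρ, (x : ℝ) = δ ∧
      IsSIndecomposable (realOrder ρ) (signature x) x ∧
      ∃ (ε : (realOrder ρ)ˣ) (α : realField ρ),
        IsSIndecomposable (realOrder ρ) (totallyPositive (realField ρ)) α ∧
        ((α : ℝ) = 1 ∨
          ∃ v W : ℕ, (v : ℤ) ≤ a ∧ (W : ℤ) ≤ a - v ∧ (α : ℝ) = triangleElement a v W ρ') ∧
        x = ((ε : realOrder ρ) : realField ρ) * α := by
  change IsSimplestCubicRoot a ρ at hρ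
  have hρ0 : 0 < ρ := by
    have : (-1 : ℝ) ≤ a := by exact_mod_cast ha
    linarith
  have H := hρ.isInvRoot hρ0
  obtain rfl : ρ' = -(1 + ρ⁻¹) := H.eq_neg_one_add_of_lt_neg_one hρ' hρ'_lt
  rw [neg_neg, neg_sq] at hδ
  obtain ⟨u, hu, α, hα, rfl⟩ := H.isUnitMulTriangle_of_isSemiconvergent ha hδ
  obtain ⟨ε, rfl⟩ := hρ.exists_unit_of_mem_rootUnits hu
  obtain ⟨x, rfl, hx⟩ := hρ.exists_isSIndecomposable_of_isOneOrTriangle hρ0 hα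
  exact ⟨ε * x, rfl, hx.unit_mul ε, ε, x, hx, hα, rfl⟩
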